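/- Let $q$ be a prime power and let $\mathcal H_q$ be the Hermitian curve over $\mathbb F_{q^2}$, with affine equation $x^{q+1}=y^q+y$, of genus $g=q(q-1)/2$. Its function field $\mathbb F_{q^2}(\mathcal H_q)=\mathbb F_{q^2}(x,y)$ has exactly one place $P_\infty$ at infinity, that is, exactly one place at which $x$ or $y$ has a pole. For a divisor $D$ let $\mathcal L(D)=\{f\in\mathbb F_{q^2}(\mathcal H_q)\setminus\{0\}: (f)+D\ge 0\}\cup\{0\}$, and write $[n]=\{1,\dots,n\}$ (so $[0]=\emptyset$). Let $m\in\{q-1,\dots,q^2-1\}$, let $L=mq-g$, and let $\alpha_1,\dots,\alpha_m$ be distinct elements of $\mathbb F_{q^2}\setminus\{0\}$. For $z\in[q]$ and $i\in[m-z+1]$ put $$\bar h^{(z)}_i=y^{z-1}\prod_{i'\in[m-z+1]\setminus\{i\}}(x-\alpha_{i'}).$$ Then these functions are pairwise distinct, there are exactly $L$ of them, and they form an $\mathbb F_{q^2}$-basis of $\mathcal L((L+g-1)P_\infty)=\mathcal L((mq-1)P_\infty)$. -/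

import Mathlib

open Polynomial
open scoped Polynomial.Bivariate

noncomputable section

/-- The polynomial `Y ^ q + Y - X ^ (q + 1)` in `k[X][Y]`, defining the affine Hermitian curve. -/
def hermitianPolynomial (k : Type*) [Field k] (q : ℕ) : k[X][Y] :=
  Y ^ q + Y - C (X ^ (q + 1))

/-- Exchanging the variables turns the defining polynomial into an Eisenstein polynomial
(at the prime `Y` of `k[Y]`). -/
theorem hermitianPolynomial_irreducible (k : Type*) [Field k] {q : ℕ} (hq : 2 ≤ q) :
    Irreducible (hermitianPolynomial k q) := by
  have hsw : Bivariate.swap (hermitianPolynomial k q)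
      = -(X ^ (q + 1) - C ((X : k[X]) ^ q + X)) := by
    simp [hermitianPolynomial, Bivariate.swap_X, Bivariate.swap_Y]
  have hI : Irreducible ((X : k[X][Y]) ^ (q + 1) - C ((X : k[X]) ^ q + X)) := by
    refine (Polynomial.irreducible_of_eisenstein_criterion (P := Ideal.span {(X : k[X])})
      ?_ ?_ ?_ ?_ ?_ ?_)
    · exact (Ideal.span_singleton_prime X_ne_zero).2 prime_X
    · rw [(monic_X_pow_sub_C _ (Nat.succ_ne_zero q)).leadingCoeff, Ideal.mem_span_singleton]
      exact fun h => prime_X.not_isUnit (isUnit_of_dvd_one h)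
    · intro n hn
      rw [degree_X_pow_sub_C (Nat.succ_pos q)] at hn
      have hn' : n ≠ q + 1 := by
        rintro rfl
        exact lt_irrefl _ hn
      rw [Ideal.mem_span_singleton, coeff_sub, coeff_X_pow, if_neg hn', coeff_C, zero_sub, dvd_neg]
      split_ifs with h0
      · exact dvd_add (dvd_pow_self _ (by omega)) dvd_rfl
      · exact dvd_zero _
    · rw [degree_X_pow_sub_C (Nat.succ_pos q)]
      exact_mod_cast Nat.succ_pos q
    · rw [Ideal.span_singleton_pow, Ideal.mem_span_singleton, coeff_sub, coeff_X_pow,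
        if_neg (Nat.succ_ne_zero q).symm, coeff_C_zero, zero_sub, dvd_neg, X_pow_dvd_iff]
      intro h
      have := h 1 (by norm_num)
      rw [coeff_add, coeff_X_pow, if_neg (by omega), coeff_X_one, zero_add] at this
      exact one_ne_zero this
    · exact (monic_X_pow_sub_C _ (Nat.succ_ne_zero q)).isPrimitive
  rw [← MulEquiv.irreducible_iff (Bivariate.swap (R := k)), hsw]
  exact (Associated.refl _).neg_left.irreducible_iff.2 hI

namespace Hermitian

/-- The affine coordinate ring `k[X, Y] / (Y ^ q + Y - X ^ (q + 1))`. -/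
abbrev CoordinateRing (k : Type*) [Field k] (q : ℕ) : Type _ :=
  AdjoinRoot (hermitianPolynomial k q)

instance (k : Type*) [Field k] (q : ℕ) [hq : Fact (IsPrimePow q)] :
    IsDomain (CoordinateRing k q) :=
  AdjoinRoot.isDomain_of_prime (hermitianPolynomial_irreducible k hq.out.two_le).prime

/-- The function field `k(x, y)`, `x ^ (q + 1) = y ^ q + y`, of the Hermitian curve. -/
abbrev FunctionField (k : Type*) [Field k] (q : ℕ) : Type _ :=
  FractionRing (CoordinateRing k q)

/-- The coordinate function `x`. -/
def x (k : Type*) [Field k] (q : ℕ) : FunctionField k q :=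
  algebraMap (CoordinateRing k q) _ (AdjoinRoot.of _ X)

/-- The coordinate function `y`. -/
def y (k : Type*) [Field k] (q : ℕ) : FunctionField k q :=
  algebraMap (CoordinateRing k q) _ (AdjoinRoot.root _)

end Hermitian

/-- A place of `F / k`: a discrete valuation ring with fraction field `F` that contains `k`.
If `F` is the function field of a non-singular projective curve over `k`, these are the local
rings of the closed points of the curve. -/
structure Place (k F : Type*) [Field k] [Field F] [Algebra k F] where
  ring : ValuationSubring F
  algebraMap_mem : ∀ c : k, algebraMap k F c ∈ ring
  isDVR : IsDiscreteValuationRing ring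

namespace Place

variable {k F : Type*} [Field k] [Field F] [Algebra k F]

instance (P : Place k F) : IsDiscreteValuationRing P.ring := P.isDVR

/-- The normalized valuation at `P`, written multiplicatively: for `f ≠ 0` it takes the value
`exp (-v_P(f))`, and it is `0` at `f = 0`. -/
def valuation (P : Place k F) : Valuation F (WithZero (Multiplicative ℤ)) :=
  (IsDiscreteValuationRing.maximalIdeal P.ring).valuation F

theorem valuation_algebraMap_le_one (P : Place k F) (c : k) :
    P.valuation (algebraMap k F c) ≤ 1 :=
  (IsDiscreteValuationRing.maximalIdeal P.ring).valuation_le_one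
    (⟨algebraMap k F c, P.algebraMap_mem c⟩ : P.ring)

end Place

/-- Divisors of `F / k`: formal finite `ℤ`-linear combinations of places. -/
abbrev FunctionFieldDivisor (k F : Type*) [Field k] [Field F] [Algebra k F] : Type _ :=
  Place k F →₀ ℤ

/-- The Riemann-Roch space `L(D) = {f : (f) + D ≥ 0} ∪ {0}`, that is, all `f` with `f = 0` or
`v_P(f) ≥ - D(P)` for every place `P`. -/
def riemannRochSpace {k F : Type*} [Field k] [Field F] [Algebra k F]
    (D : FunctionFieldDivisor k F) : Submodule k F where
  carrier := {f | ∀ P : Place k F, P.valuation f ≤ WithZero.exp (D P)}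
  zero_mem' := fun P => by simp
  add_mem' := fun ha hb P => (P.valuation.map_add _ _).trans (max_le (ha P) (hb P))
  smul_mem' := fun c f hf P => by
    rw [Algebra.smul_def, map_mul]
    exact (mul_le_mul' (P.valuation_algebraMap_le_one c) (hf P)).trans_eq (one_mul _)

namespace Hermitian

/-- A place of the function field of the Hermitian curve lies at infinity if it is not a place of
the affine curve, i.e. if `x` or `y` has a pole there. -/
def IsAtInfinity {k : Type*} [Field k] {q : ℕ} [Fact (IsPrimePow q)]
    (P : Place k (FunctionField k q)) : Prop :=
  x k q ∉ P.ring ∨ y k q ∉ P.ring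

/-- The number `q (q - 1) / 2`, the genus of the Hermitian curve. -/
def genus (q : ℕ) : ℕ := q * (q - 1) / 2

/-- The index set of all pairs `(z, i)` with `z ∈ [q]` and `i ∈ [m - z + 1]`, counted from zero:
`(a, b)` stands for `z = a + 1`, `i = b + 1`, so `a < q` and `b < m - a`. -/
abbrev Index (q m : ℕ) : Type := Σ a : Fin q, Fin (m - a)

/-- The function `y ^ (z - 1) * ∏ (x - α i')`, the product over `i' ∈ [m - z + 1]`, `i' ≠ i`,
at the index `(z, i) = (a + 1, b + 1)`. -/
def hBar {k : Type*} [Field k] {q m : ℕ} [Fact (IsPrimePow q)] (α : Fin m → k)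
    (s : Index q m) : FunctionField k q :=
  y k q ^ (s.1 : ℕ) *
    ∏ j ∈ Finset.univ.erase s.2,
      (x k q - algebraMap k (FunctionField k q) (α (j.castLE (Nat.sub_le m s.1))))

end Hermitian

end

noncomputable section
namespace Hermitian

/-! ### Normal forms of functions on the affine curve -/

section Affine

variable {k : Type*} [Field k] {q : ℕ}

/-! No Riemann–Roch theorem is needed: the space is computed outright. Modulo the curve equation
every polynomial in `x`, `y` becomes `∑ p a (x) * y ^ a` with `a < q`.

At infinity, `x ^ (q + 1) = y ^ q + y` forces `v x = t ^ q` and `v y = t ^ (q + 1)` with `t = v y /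
v x > 1`. The monomials `x ^ i * y ^ a` have exponents `q * i + (q + 1) * a`, which separate
distinct `a < q` modulo `q`, so no cancellation occurs and the value of the sum is `t ^ weight p`
(`valuation_evalXY`). This determines the place at infinity and makes `evalXY` injective.

Away from infinity, a function without poles is integral over `k[x]`. Since `q = 0` in `k`, the
minimal polynomial of `y` has derivative `1`, so `1, y, …, y ^ (q - 1)` has discriminant `±1` and
the function lies in `k[x, y]` (`exists_eq_evalXY_of_forall_mem`).

Hence the space consists of the `evalXY p` with `weight p ≤ m * q - 1`, which means `deg (p a) < m -
a` for every `a`. For fixed `a`, the Lagrange products on the first `m - a` nodes form a basis of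
these polynomials (`span_hBar_eq`). -/

theorem natDegree_hermitianPolynomial (hq : 2 ≤ q) :
    (hermitianPolynomial k q).natDegree = q := by
  have h1 : (hermitianPolynomial k q) = Y ^ q + (Y - C (X ^ (q + 1))) := by
    rw [hermitianPolynomial]; ring
  rw [h1, natDegree_add_eq_left_of_natDegree_lt, natDegree_X_pow]
  rw [natDegree_X_pow, natDegree_X_sub_C]
  omega

theorem monic_hermitianPolynomial (hq : 2 ≤ q) : (hermitianPolynomial k q).Monic := by
  have h1 : (hermitianPolynomial k q) = Y ^ q + (Y - C (X ^ (q + 1))) := by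
    rw [hermitianPolynomial]; ring
  rw [h1]
  apply monic_X_pow_add
  rw [degree_X_sub_C]
  exact_mod_cast hq

theorem derivative_hermitianPolynomial (hq0 : (q : k) = 0) :
    derivative (hermitianPolynomial k q) = 1 := by
  have : (q : k[X][Y]) = 0 := by
    rw [← map_natCast (C.comp C : k →+* k[X][Y]), hq0, map_zero]
  rw [hermitianPolynomial, derivative_sub, derivative_C]
  simp [derivative_X_pow, this]

theorem algebraMap_polynomial_apply (p : k[X]) :
    algebraMap k[X] (FunctionField k q) p = aeval (x k q) p := by
  have : x k q = algebraMap k[X] (FunctionField k q) X := rfl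
  rw [this, aeval_algebraMap_apply, aeval_X_left_apply]

theorem aeval_y (g : k[X][Y]) :
    aeval (y k q) g = algebraMap (CoordinateRing k q) _ (AdjoinRoot.mk _ g) := by
  rw [y, aeval_algebraMap_apply, AdjoinRoot.aeval_eq]

/-- The equation of the curve. -/
theorem x_pow_eq : x k q ^ (q + 1) = y k q ^ q + y k q := by
  have h := aeval_y (k := k) (q := q) (hermitianPolynomial k q)
  rw [AdjoinRoot.mk_self, map_zero] at h
  have h2 : algebraMap k[X] (FunctionField k q) X = x k q := rfl
  simp only [hermitianPolynomial, map_sub, map_add, map_pow, aeval_X, aeval_C, h2] at h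
  exact (sub_eq_zero.1 h).symm

/-- The function `∑ a, p a (x) * y ^ a`. -/
def evalXY (p : Fin q → k[X]) : FunctionField k q :=
  ∑ a, aeval (x k q) (p a) * y k q ^ (a : ℕ)

open Classical in
/-- The weighted degree of a family `p`, where `x` has weight `q` and `y` has weight `q + 1`. -/
def weight (p : Fin q → k[X]) : ℕ :=
  Finset.univ.sup fun a => if p a = 0 then 0 else q * (p a).natDegree + (q + 1) * a

theorem evalXY_zero : evalXY (0 : Fin q → k[X]) = 0 := by simp [evalXY]

end Affine

variable {k : Type*} [Field k] {q : ℕ} [hq : Fact (IsPrimePow q)]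

/-- Division by the monic curve equation leaves a remainder of degree less than `q` in `Y`. -/
theorem exists_evalXY_eq_aeval_y (g : k[X][Y]) : ∃ p, evalXY p = aeval (y k q) g := by
  have hq2 := hq.out.two_le
  have hmon := monic_hermitianPolynomial (k := k) hq2
  set r := g %ₘ hermitianPolynomial k q with hr
  have hg : aeval (y k q) g = aeval (y k q) r := by
    rw [aeval_y, aeval_y]
    congr 1
    rw [AdjoinRoot.mk_eq_mk, hr]
    exact dvd_sub_comm.1 ⟨-(g /ₘ hermitianPolynomial k q), by
      linear_combination modByMonic_add_div g (hermitianPolynomial k q)⟩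
  have hdeg : r.natDegree < q := by
    have := natDegree_modByMonic_lt g hmon (by
      intro h
      have := natDegree_hermitianPolynomial (k := k) hq2
      rw [h, natDegree_one] at this
      omega)
    rwa [natDegree_hermitianPolynomial hq2] at this
  refine ⟨fun a => r.coeff a, ?_⟩
  rw [hg, aeval_eq_sum_range' hdeg, evalXY, Finset.sum_range]
  refine Finset.sum_congr rfl fun a _ => ?_
  rw [Algebra.smul_def, algebraMap_polynomial_apply]

theorem exists_eq_evalXY_div (f : FunctionField k q) :
    ∃ p p' : Fin q → k[X], evalXY p' ≠ 0 ∧ f = evalXY p / evalXY p' := by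
  obtain ⟨a, b, hb, rfl⟩ := IsFractionRing.div_surjective (CoordinateRing k q) f
  obtain ⟨a, rfl⟩ := AdjoinRoot.mk_surjective a
  obtain ⟨b, rfl⟩ := AdjoinRoot.mk_surjective b
  obtain ⟨p, hp⟩ := exists_evalXY_eq_aeval_y (q := q) a
  obtain ⟨p', hp'⟩ := exists_evalXY_eq_aeval_y (q := q) b
  rw [aeval_y] at hp hp'
  refine ⟨p, p', ?_, by rw [hp, hp']⟩
  rw [hp']
  exact IsLocalization.to_map_ne_zero_of_mem_nonZeroDivisors _ le_rfl hb

/-! ### Valuations with a pole at `x` or `y` -/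

section Valuation

variable {Γ : Type*} [LinearOrderedCommGroupWithZero Γ] (v : Valuation (FunctionField k q) Γ)

-- If `y` were regular, so would be `x ^ (q + 1) = y ^ q + y`, and hence `x`.
omit hq in
theorem one_lt_valuation_y (h : 1 < v (x k q) ∨ 1 < v (y k q)) : 1 < v (y k q) := by
  by_contra! hy
  have hx := h.resolve_right hy.not_gt
  have h1 : v (x k q ^ (q + 1)) ≤ 1 := by
    rw [x_pow_eq]
    refine (v.map_add _ _).trans (max_le ?_ hy)
    rw [map_pow]
    exact pow_le_one' hy q
  rw [map_pow] at h1
  exact (one_lt_pow₀ hx (Nat.succ_ne_zero q)).not_ge h1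

/-- At a pole of `y` the term `y ^ q` strictly dominates `y`, because `q ≥ 2`. -/
theorem valuation_x_pow (h : 1 < v (y k q)) : v (x k q) ^ (q + 1) = v (y k q) ^ q := by
  rw [← map_pow, x_pow_eq, Valuation.map_add_eq_of_lt_left, map_pow]
  rw [map_pow]
  exact lt_self_pow₀ h hq.out.two_le

theorem valuation_x_ne_zero (h : 1 < v (y k q)) : v (x k q) ≠ 0 := by
  intro h0
  have h1 := valuation_x_pow v h
  rw [h0, zero_pow (Nat.succ_ne_zero q)] at h1
  exact pow_ne_zero q (zero_lt_one.trans h).ne' h1.symm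

theorem valuation_y_eq (h : 1 < v (y k q)) :
    v (y k q) = (v (y k q) / v (x k q)) ^ (q + 1) := by
  have h0 := (zero_lt_one.trans h).ne'
  rw [div_pow, valuation_x_pow v h, pow_succ, mul_comm,
    mul_div_assoc, div_self (pow_ne_zero q h0), mul_one]

theorem valuation_x_eq (h : 1 < v (y k q)) :
    v (x k q) = (v (y k q) / v (x k q)) ^ q := by
  have h0 := valuation_x_ne_zero v h
  rw [div_pow, ← valuation_x_pow v h, pow_succ, mul_comm,
    mul_div_assoc, div_self (pow_ne_zero q h0), mul_one]

theorem one_lt_valuation_y_div_x (h : 1 < v (y k q)) : 1 < v (y k q) / v (x k q) := by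
  by_contra! h1
  have := valuation_y_eq v h
  rw [this] at h
  exact (pow_le_one' h1 _).not_gt h

theorem one_lt_valuation_x (h : 1 < v (y k q)) : 1 < v (x k q) := by
  rw [valuation_x_eq v h]
  exact one_lt_pow₀ (one_lt_valuation_y_div_x v h) hq.out.ne_zero

variable [v.IsTrivialOn k]

theorem valuation_term (h : 1 < v (y k q)) {p : k[X]} (hp : p ≠ 0) (a : ℕ) :
    v (aeval (x k q) p * y k q ^ a)
      = (v (y k q) / v (x k q)) ^ (q * p.natDegree + (q + 1) * a) := by
  rw [map_mul, map_pow, valuation_aeval_eq_valuation_X_pow_natDegree_of_one_lt_valuation_X _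
    (one_lt_valuation_x v h) hp, pow_add, pow_mul, pow_mul, ← valuation_x_eq v h,
    ← valuation_y_eq v h]

/-- The orders at infinity of the monomials `x ^ i * y ^ a`, `a < q`, are pairwise different. -/
theorem valuation_evalXY (h : 1 < v (y k q)) {p : Fin q → k[X]} (hp : p ≠ 0) :
    v (evalXY p) = (v (y k q) / v (x k q)) ^ weight p := by
  classical
  obtain ⟨a₀, ha₀⟩ := Function.ne_iff.1 hp
  have hT := one_lt_valuation_y_div_x v h
  set S : Finset (Fin q) := Finset.univ.filter fun a => p a ≠ 0
  have hS : S.Nonempty := ⟨a₀, by simpa [S] using ha₀⟩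
  obtain ⟨b, hb, hmax⟩ := S.exists_max_image (fun a => q * (p a).natDegree + (q + 1) * (a : ℕ)) hS
  have hb0 : p b ≠ 0 := by simpa [S] using hb
  have hw : weight p = q * (p b).natDegree + (q + 1) * (b : ℕ) := by
    apply le_antisymm
    · rw [weight]
      refine Finset.sup_le fun a _ => ?_
      split_ifs with ha
      · exact Nat.zero_le _
      · exact hmax a (by simpa [S] using ha)
    · have := Finset.le_sup (f := fun a : Fin q =>
        if p a = 0 then 0 else q * (p a).natDegree + (q + 1) * (a : ℕ)) (Finset.mem_univ b)
      rw [if_neg hb0] at this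
      exact this
  rw [hw, ← valuation_term v h hb0, evalXY]
  refine Valuation.map_sum_eq_of_lt v (Finset.mem_univ b) fun a ha => ?_
  rw [valuation_term v h hb0]
  by_cases ha0 : p a = 0
  · rw [ha0, map_zero, zero_mul, map_zero]
    exact pow_pos (zero_lt_one.trans hT) _
  rw [valuation_term v h ha0]
  refine pow_lt_pow_right₀ hT (lt_of_le_of_ne (hmax a (by simpa [S] using ha0)) fun he => ?_)
  have hab : a ≠ b := by simpa using ha
  apply hab
  -- Equal exponents would agree modulo `q`, where `q * d + (q + 1) * c` reduces to `c`.
  have he' := congrArg (· % q) he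
  have key (d c : ℕ) (hc : c < q) : (q * d + (q + 1) * c) % q = c := by
    rw [show q * d + (q + 1) * c = c + q * (d + c) by ring, Nat.add_mul_mod_self_left,
      Nat.mod_eq_of_lt hc]
  simp only [key _ _ a.2, key _ _ b.2] at he'
  exact Fin.ext he'

theorem evalXY_ne_zero (h : 1 < v (y k q)) {p : Fin q → k[X]} (hp : p ≠ 0) : evalXY p ≠ 0 := by
  rw [← v.ne_zero_iff, valuation_evalXY v h hp]
  exact pow_ne_zero _ (zero_lt_one.trans (one_lt_valuation_y_div_x v h)).ne'

end Valuation

/-- The order at infinity does not depend on the valuation that is used to measure it. -/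
theorem exists_valuation_eq_zpow {f : FunctionField k q} (hf : f ≠ 0) :
    ∃ n : ℤ, ∀ (O : ValuationSubring (FunctionField k q)) [O.valuation.IsTrivialOn k],
      1 < O.valuation (y k q) →
      O.valuation f = (O.valuation (y k q) / O.valuation (x k q)) ^ n := by
  obtain ⟨p, p', hp', rfl⟩ := exists_eq_evalXY_div f
  refine ⟨weight p - weight p', fun O _ h => ?_⟩
  have h0 : p ≠ 0 := by
    rintro rfl
    exact hf (by rw [evalXY_zero, zero_div])
  have h0' : p' ≠ 0 := by
    rintro rfl
    exact hp' evalXY_zero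
  rw [map_div₀, valuation_evalXY _ h h0, valuation_evalXY _ h h0', zpow_sub₀
    (zero_lt_one.trans (one_lt_valuation_y_div_x _ h)).ne', zpow_natCast, zpow_natCast]

end Hermitian

/-! ### A criterion for discreteness -/

namespace ValuationSubring

/-- A valuation ring whose value group is generated by the value of one element of the maximal
ideal is a discrete valuation ring. -/
theorem isDiscreteValuationRing_of_forall_eq_zpow {F : Type*} [Field F] (O : ValuationSubring F)
    {t : F} (ht0 : t ≠ 0) (ht : O.valuation t < 1)
    (h : ∀ f ≠ 0, ∃ n : ℤ, O.valuation f = O.valuation t ^ n) :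
    IsDiscreteValuationRing O := by
  have hv0 : 0 < O.valuation t := zero_lt_iff.2 (O.valuation.ne_zero_iff.2 ht0)
  let τ : O := ⟨t, (O.valuation_le_one_iff t).1 ht.le⟩
  have key : ∀ f : O, f ≠ 0 → ∃ n : ℕ, O.valuation f = O.valuation t ^ n := by
    intro f hf
    obtain ⟨n, hn⟩ := h f (by simpa using hf)
    have hn0 : 0 ≤ n := by
      by_contra! hlt
      have h1 : O.valuation (f : F) ≤ 1 := (O.valuation_le_one_iff _).2 f.2
      rw [hn] at h1
      exact (one_lt_zpow_of_neg₀ hv0 ht hlt).not_ge h1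
    lift n to ℕ using hn0
    exact ⟨n, by rw [hn, zpow_natCast]⟩
  have assoc : ∀ (f : O) (n : ℕ), O.valuation f = O.valuation t ^ n → Associated (τ ^ n) f := by
    intro f n hn
    have hf : O.valuation ((f : F) / t ^ n) = 1 := by
      rw [map_div₀, map_pow, hn, div_self (pow_ne_zero _ hv0.ne')]
    let u : O := ⟨f / t ^ n, (O.valuation_le_one_iff _).1 hf.le⟩
    have hu : IsUnit u := (O.valuation_eq_one_iff u).2 hf
    refine ⟨hu.unit, Subtype.ext ?_⟩
    change t ^ n * (f / t ^ n) = f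
    field_simp
  refine IsDiscreteValuationRing.ofHasUnitMulPowIrreducibleFactorization ⟨τ, ?_, ?_⟩
  -- In a factorization of `t` the two natural exponents add up to `1`, so one of them is `0` and
  -- that factor is a unit.
  · refine ⟨fun hu => ht.ne ((O.valuation_eq_one_iff τ).1 hu), fun a b hab => ?_⟩
    have hab' : t = (a : F) * b := congrArg Subtype.val hab
    have ha0 : a ≠ 0 := by
      rintro rfl
      exact ht0 (by simpa using hab')
    have hb0 : b ≠ 0 := by
      rintro rfl
      exact ht0 (by simpa using hab')
    obtain ⟨m, hm⟩ := key a ha0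
    obtain ⟨n, hn⟩ := key b hb0
    have hmn : O.valuation t ^ (m + n) = O.valuation t ^ 1 := by
      rw [pow_add, ← hm, ← hn, ← map_mul, ← hab', pow_one]
    have := pow_right_injective₀ hv0 ht.ne hmn
    rcases Nat.add_eq_one_iff.1 this with h | h
    · exact Or.inl ((O.valuation_eq_one_iff a).2 (by rw [hm, h.1, pow_zero]))
    · exact Or.inr ((O.valuation_eq_one_iff b).2 (by rw [hn, h.2, pow_zero]))
  · intro f hf
    obtain ⟨n, hn⟩ := key f hf
    exact ⟨n, assoc f n hn⟩

end ValuationSubring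

/-! ### Generalities on places -/

namespace Place

variable {k F : Type*} [Field k] [Field F] [Algebra k F]

theorem valuation_le_one_iff (P : Place k F) {f : F} : P.valuation f ≤ 1 ↔ f ∈ P.ring := by
  constructor
  · intro h
    obtain ⟨a, rfl⟩ := IsDiscreteValuationRing.exists_lift_of_le_one h
    exact a.2
  · intro h
    exact (IsDiscreteValuationRing.maximalIdeal P.ring).valuation_le_one (⟨f, h⟩ : P.ring)

theorem ext_ring {P Q : Place k F} (h : P.ring = Q.ring) : P = Q := by
  cases P
  cases Q
  congr

instance (P : Place k F) : P.valuation.IsTrivialOn k where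
  eq_one a ha := by
    refine le_antisymm (P.valuation_algebraMap_le_one a) ?_
    have h := P.valuation_algebraMap_le_one a⁻¹
    rw [map_inv₀, map_inv₀] at h
    rwa [← inv_le_one₀ (zero_lt_iff.2 (P.valuation.ne_zero_iff.2 (by simpa using ha)))]

theorem _root_.ValuationSubring.isTrivialOn {O : ValuationSubring F}
    (hO : ∀ c : k, algebraMap k F c ∈ O) : O.valuation.IsTrivialOn k where
  eq_one a ha := by
    refine le_antisymm ((O.valuation_le_one_iff _).2 (hO a)) ?_
    have h := (O.valuation_le_one_iff _).2 (hO a⁻¹)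
    rw [map_inv₀, map_inv₀] at h
    rwa [← inv_le_one₀ (zero_lt_iff.2 (O.valuation.ne_zero_iff.2 (by simpa using ha)))]

end Place

/-! ### The place at infinity -/

namespace Hermitian

variable {k : Type*} [Field k] {q : ℕ} [hq : Fact (IsPrimePow q)]

theorem injective_algebraMap_polynomial :
    Function.Injective (algebraMap k[X] (FunctionField k q)) := by
  have h1 : Function.Injective (algebraMap k[X] (CoordinateRing k q)) := by
    refine AdjoinRoot.of.injective_of_degree_ne_zero ?_
    rw [degree_eq_natDegree (monic_hermitianPolynomial hq.out.two_le).ne_zero,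
      natDegree_hermitianPolynomial hq.out.two_le]
    exact_mod_cast hq.out.ne_zero
  rw [IsScalarTower.algebraMap_eq k[X] (CoordinateRing k q) (FunctionField k q)]
  exact (IsFractionRing.injective (CoordinateRing k q) (FunctionField k q)).comp h1

theorem transcendental_x : Transcendental k (x k q) := by
  rw [transcendental_iff_injective]
  intro a b hab
  rw [← algebraMap_polynomial_apply, ← algebraMap_polynomial_apply] at hab
  exact injective_algebraMap_polynomial hab

/-- Since `x` is transcendental, it lies outside the integral closure of `k`, so some valuation ring
over `k` omits it. All values there are powers of that of `x / y`, which makes the ring discrete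
with uniformizer `x / y`. -/
theorem exists_isAtInfinity :
    ∃ P : Place k (FunctionField k q), IsAtInfinity P := by
  let R := (integralClosure k (FunctionField k q)).toSubring
  have : IsIntegrallyClosedIn R (FunctionField k q) :=
    inferInstanceAs (IsIntegrallyClosedIn (integralClosure k (FunctionField k q)) _)
  have hx : x k q ∉ R := fun h => transcendental_x (IsIntegral.isAlgebraic h)
  obtain ⟨O, hRO, hxO⟩ := Subring.exists_le_valuationSubring_of_isIntegrallyClosedIn hx
  have hk : ∀ c : k, algebraMap k (FunctionField k q) c ∈ O := fun c =>
    hRO (algebraMap_mem (integralClosure k (FunctionField k q)) c)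
  have := ValuationSubring.isTrivialOn hk
  have hy := one_lt_valuation_y O.valuation
    (Or.inl (not_le.1 (mt (O.valuation_le_one_iff _).1 hxO)))
  have hT := one_lt_valuation_y_div_x O.valuation hy
  refine ⟨⟨O, hk, ?_⟩, Or.inl hxO⟩
  have hinv : O.valuation (x k q / y k q) = (O.valuation (y k q) / O.valuation (x k q))⁻¹ := by
    rw [map_div₀, inv_div]
  refine O.isDiscreteValuationRing_of_forall_eq_zpow (t := x k q / y k q) ?_ ?_ ?_
  · rw [← O.valuation.ne_zero_iff, hinv]
    exact inv_ne_zero (zero_lt_one.trans hT).ne'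
  · rw [hinv]
    exact inv_lt_one_of_one_lt₀ hT
  · intro f hf
    obtain ⟨n, hn⟩ := exists_valuation_eq_zpow hf
    exact ⟨-n, by rw [hn O hy, hinv, inv_zpow', neg_neg]⟩

theorem IsAtInfinity.one_lt_valuation_y {P : Place k (FunctionField k q)} (hP : IsAtInfinity P) :
    1 < P.valuation (y k q) := by
  apply Hermitian.one_lt_valuation_y
  rwa [← not_le, ← not_le, P.valuation_le_one_iff, P.valuation_le_one_iff]

/-- Membership of `f` in the ring depends only on the sign of its exponent `n`, which is the same
for all places at infinity. -/
theorem IsAtInfinity.eq {P Q : Place k (FunctionField k q)} (hP : IsAtInfinity P)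
    (hQ : IsAtInfinity Q) : P = Q := by
  refine Place.ext_ring (SetLike.ext fun f => ?_)
  by_cases hf : f = 0
  · rw [hf]
    exact ⟨fun _ => zero_mem _, fun _ => zero_mem _⟩
  obtain ⟨n, hn⟩ := exists_valuation_eq_zpow hf
  have key (P : Place k (FunctionField k q)) (hP : IsAtInfinity P) : f ∈ P.ring ↔ n ≤ 0 := by
    have := ValuationSubring.isTrivialOn P.algebraMap_mem
    have hy := Hermitian.one_lt_valuation_y P.ring.valuation (by
      rwa [← not_le, ← not_le, P.ring.valuation_le_one_iff, P.ring.valuation_le_one_iff])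
    rw [← P.ring.valuation_le_one_iff, hn P.ring hy,
      zpow_le_one_iff_right₀ (one_lt_valuation_y_div_x _ hy)]
  rw [key P hP, key Q hQ]

theorem existsUnique_isAtInfinity : ∃! P : Place k (FunctionField k q), IsAtInfinity P := by
  obtain ⟨P, hP⟩ := exists_isAtInfinity (k := k) (q := q)
  exact ⟨P, hP, fun Q hQ => hQ.eq hP⟩

/-- The normalized valuation attains `exp 1`, yet all its nonzero values are powers of this quotient
`exp e`; so `e` divides `1`, and `e > 0`. -/
theorem IsAtInfinity.valuation_y_div_x {P : Place k (FunctionField k q)} (hP : IsAtInfinity P) :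
    P.valuation (y k q) / P.valuation (x k q) = WithZero.exp (1 : ℤ) := by
  have hy := hP.one_lt_valuation_y
  have hT := one_lt_valuation_y_div_x P.valuation hy
  obtain ⟨f, hf⟩ : ∃ f, P.valuation f = WithZero.exp (1 : ℤ) :=
    (IsDiscreteValuationRing.maximalIdeal P.ring).valuation_surjective _ _
  have hf0 : f ≠ 0 := by
    rintro rfl
    rw [map_zero] at hf
    exact WithZero.exp_ne_zero hf.symm
  obtain ⟨p, p', hp', rfl⟩ := exists_eq_evalXY_div f
  have h0 : p ≠ 0 := by
    rintro rfl
    exact hf0 (by rw [evalXY_zero, zero_div])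
  have h0' : p' ≠ 0 := by
    rintro rfl
    exact hp' evalXY_zero
  rw [map_div₀, valuation_evalXY _ hy h0, valuation_evalXY _ hy h0'] at hf
  obtain ⟨e, he⟩ : ∃ e : ℤ, P.valuation (y k q) / P.valuation (x k q) = WithZero.exp e :=
    ⟨_, (WithZero.exp_log (zero_lt_one.trans hT).ne').symm⟩
  rw [he] at hf hT ⊢
  rw [← WithZero.exp_nsmul, ← WithZero.exp_nsmul, ← WithZero.exp_sub, WithZero.exp_inj] at hf
  rw [← WithZero.exp_zero, WithZero.exp_lt_exp] at hT
  rw [nsmul_eq_mul, nsmul_eq_mul, ← sub_mul] at hf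
  rw [WithZero.exp_inj]
  exact Int.eq_one_of_dvd_one hT.le (Dvd.intro_left _ hf)

theorem IsAtInfinity.valuation_evalXY {P : Place k (FunctionField k q)} (hP : IsAtInfinity P)
    {p : Fin q → k[X]} (hp : p ≠ 0) : P.valuation (evalXY p) = WithZero.exp (weight p : ℤ) := by
  rw [Hermitian.valuation_evalXY _ hP.one_lt_valuation_y hp, hP.valuation_y_div_x,
    ← WithZero.exp_nsmul, nsmul_eq_mul, mul_one]

end Hermitian

/-! ### Regular functions on the affine curve -/

namespace Hermitian

variable {k : Type*} [Field k] {q : ℕ} [hq : Fact (IsPrimePow q)]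

omit hq in
theorem aeval_y_hermitianPolynomial : aeval (y k q) (hermitianPolynomial k q) = 0 := by
  rw [aeval_y, AdjoinRoot.mk_self, map_zero]

theorem isIntegral_y : IsIntegral k[X] (y k q) :=
  ⟨hermitianPolynomial k q, monic_hermitianPolynomial hq.out.two_le, aeval_y_hermitianPolynomial⟩

section FractionField

variable (K : Type*) [Field K] [Algebra k[X] K] [IsFractionRing k[X] K]
  [Algebra K (FunctionField k q)] [IsScalarTower k[X] K (FunctionField k q)]

/-- By Gauss's lemma the monic curve equation stays irreducible over the fraction field of `k[X]`.
-/
theorem minpoly_y :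
    minpoly K (y k q) = (hermitianPolynomial k q).map (algebraMap k[X] K) := by
  have hmon := monic_hermitianPolynomial (k := k) hq.out.two_le
  refine (minpoly.eq_of_irreducible_of_monic ?_ ?_ (hmon.map _)).symm
  · exact (hmon.irreducible_iff_irreducible_map_fraction_map).1
      (hermitianPolynomial_irreducible k hq.out.two_le)
  · rw [aeval_map_algebraMap, aeval_y_hermitianPolynomial]

theorem derivative_minpoly_y (hq0 : (q : k) = 0) : derivative (minpoly K (y k q)) = 1 := by
  rw [minpoly_y, derivative_map, derivative_hermitianPolynomial hq0, Polynomial.map_one]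

omit [IsFractionRing k[X] K] in
theorem adjoin_y_eq_top : Algebra.adjoin K {y k q} = ⊤ := by
  have hy : IsIntegral K (y k q) := isIntegral_y.tower_top
  have hsub : ∀ g : k[X][Y], aeval (y k q) g ∈ IntermediateField.adjoin K {y k q} := by
    intro g
    have h : aeval (y k q) (g.map (algebraMap k[X] K)) ∈ Algebra.adjoin K {y k q} := by
      rw [Algebra.adjoin_singleton_eq_range_aeval]
      exact ⟨_, rfl⟩
    rw [aeval_map_algebraMap] at h
    exact IntermediateField.algebra_adjoin_le_adjoin K _ h
  have htop : IntermediateField.adjoin K {y k q} = ⊤ := by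
    rw [eq_top_iff]
    intro f _
    obtain ⟨a, b, hb, rfl⟩ := IsFractionRing.div_surjective (CoordinateRing k q) f
    obtain ⟨a, rfl⟩ := AdjoinRoot.mk_surjective a
    obtain ⟨b, rfl⟩ := AdjoinRoot.mk_surjective b
    rw [← aeval_y, ← aeval_y]
    exact div_mem (hsub a) (hsub b)
  rw [← IntermediateField.adjoin_simple_toSubalgebra_of_isAlgebraic hy.isAlgebraic, htop,
    IntermediateField.top_toSubalgebra]

theorem isSeparable_functionField (hq0 : (q : k) = 0) :
    Algebra.IsSeparable K (FunctionField k q) := by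
  have hy : IsIntegral K (y k q) := isIntegral_y.tower_top
  have hsep : IsSeparable K (y k q) := by
    rw [IsSeparable, Polynomial.Separable, derivative_minpoly_y K hq0]
    exact isCoprime_one_right
  have h1 := (IntermediateField.isSeparable_adjoin_simple_iff_isSeparable K _).2 hsep
  have htop : IntermediateField.adjoin K {y k q} = ⊤ := by
    apply IntermediateField.toSubalgebra_injective
    rw [IntermediateField.adjoin_simple_toSubalgebra_of_isAlgebraic hy.isAlgebraic, adjoin_y_eq_top,
      IntermediateField.top_toSubalgebra]
  rw [htop] at h1
  exact Algebra.IsSeparable.of_algHom K _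
    (IntermediateField.topEquiv (F := K) (E := FunctionField k q)).symm.toAlgHom

omit [IsFractionRing k[X] K] in
theorem finiteDimensional_functionField : FiniteDimensional K (FunctionField k q) :=
  (PowerBasis.ofAdjoinEqTop (isIntegral_y.tower_top) (adjoin_y_eq_top K)).finite

end FractionField

/-- The affine Hermitian curve is smooth: the discriminant of `1, y, …, y ^ (q - 1)` over `k[x]`
is a unit. -/
theorem mem_adjoin_y_of_isIntegral (K : Type*) [Field K] [Algebra k[X] K] [IsFractionRing k[X] K]
    [Algebra K (FunctionField k q)] [IsScalarTower k[X] K (FunctionField k q)] (hq0 : (q : k) = 0) {f : FunctionField k q}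
    (hf : IsIntegral k[X] f) : f ∈ Algebra.adjoin k[X] {y k q} := by
  have := isSeparable_functionField (q := q) K hq0
  have := finiteDimensional_functionField (k := k) (q := q) K
  let B : PowerBasis K (FunctionField k q) :=
    PowerBasis.ofAdjoinEqTop (isIntegral_y.tower_top) (adjoin_y_eq_top K)
  have hgen : B.gen = y k q := rfl
  have h := Algebra.discr_mul_isIntegral_mem_adjoin K (R := k[X]) (B := B)
    (hgen.symm ▸ isIntegral_y) hf
  -- Up to this sign the discriminant is the norm of the derivative of `minpoly` at `y`, which is
  -- `1`.
  have hd : Algebra.discr K B.basis = (-1) ^ (B.dim * (B.dim - 1) / 2) := by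
    rw [Algebra.discr_powerBasis_eq_norm, hgen, derivative_minpoly_y K hq0, map_one, map_one,
      mul_one, B.finrank]
  rw [hgen, hd] at h
  rcases neg_one_pow_eq_or K (B.dim * (B.dim - 1) / 2) with h1 | h1
  · rwa [h1, one_smul] at h
  · rw [h1, neg_smul, one_smul] at h
    simpa using neg_mem h

/-- A function without poles on the affine Hermitian curve is a polynomial in `x` and `y`. -/
theorem exists_eq_evalXY_of_forall_mem (hq0 : (q : k) = 0) {f : FunctionField k q}
    (hf : ∀ P : Place k (FunctionField k q), ¬ IsAtInfinity P → f ∈ P.ring) :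
    ∃ p, evalXY p = f := by
  have : FaithfulSMul k[X] (FunctionField k q) :=
    (faithfulSMul_iff_algebraMap_injective _ _).2 injective_algebraMap_polynomial
  let := FractionRing.liftAlgebra k[X] (FunctionField k q)
  suffices h : IsIntegral k[X] f by
    have h2 := mem_adjoin_y_of_isIntegral (FractionRing k[X]) hq0 h
    rw [Algebra.adjoin_singleton_eq_range_aeval] at h2
    obtain ⟨g, hg⟩ := h2
    obtain ⟨p, hp⟩ := exists_evalXY_eq_aeval_y (q := q) g
    exact ⟨p, hp.trans hg⟩
  have := isSeparable_functionField (q := q) (FractionRing k[X]) hq0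
  have := finiteDimensional_functionField (k := k) (q := q) (FractionRing k[X])
  let B := integralClosure k[X] (FunctionField k q)
  have : IsDedekindDomain B := integralClosure.isDedekindDomain_fractionRing k[X] _
  have : IsFractionRing B (FunctionField k q) :=
    integralClosure.isFractionRing_of_finite_extension (FractionRing k[X]) _
  have hmem : f ∈ (algebraMap B (FunctionField k q)).range := by
    -- The Dedekind domain `B` is the intersection of its localizations at nonzero primes. Each of
    -- these is a place whose ring contains `x` and `y`, hence is not at infinity, and the
    -- hypothesis on `f` applies.
    refine IsDedekindDomain.HeightOneSpectrum.mem_integers_of_valuation_le_one _ f fun w => ?_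
    let O := (w.valuation (FunctionField k q)).valuationSubring
    have hB : ∀ g, IsIntegral k[X] g → g ∈ O := fun g hg => w.valuation_le_one (⟨g, hg⟩ : B)
    have hx : IsIntegral k[X] (x k q) := isIntegral_algebraMap (R := k[X]) (x := X)
    let P : Place k (FunctionField k q) :=
      ⟨O, fun c => hB _ ((isIntegral_algebraMap (R := k) (x := c)).tower_top), ?_⟩
    · exact hf P (not_or.2 ⟨not_not.2 (hB _ hx), not_not.2 (hB _ isIntegral_y)⟩)
    · exact (w.valuation (FunctionField k q)).valuationSubring_isDiscreteValuationRing
  obtain ⟨g, rfl⟩ := hmem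
  exact g.2

end Hermitian

/-! ### Lagrange interpolation -/

namespace Polynomial

variable {k : Type*} [Field k] {n : ℕ}

/-- The product of the linear factors at all nodes but one: up to a constant, a Lagrange basis
polynomial. -/
def prodErase (β : Fin n → k) (b : Fin n) : k[X] :=
  ∏ j ∈ Finset.univ.erase b, (X - C (β j))

theorem eval_prodErase_of_ne (β : Fin n → k) {b i : Fin n} (h : b ≠ i) :
    (prodErase β b).eval (β i) = 0 := by
  rw [prodErase, eval_prod]
  exact Finset.prod_eq_zero (Finset.mem_erase.2 ⟨h.symm, Finset.mem_univ i⟩) (by simp)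

theorem eval_prodErase_self_ne_zero {β : Fin n → k} (hβ : Function.Injective β) (b : Fin n) :
    (prodErase β b).eval (β b) ≠ 0 := by
  rw [prodErase, eval_prod, Finset.prod_ne_zero_iff]
  intro j hj
  rw [eval_sub, eval_X, eval_C, sub_ne_zero]
  exact fun h => (Finset.mem_erase.1 hj).1 (hβ h).symm

theorem natDegree_prodErase (β : Fin n → k) (b : Fin n) : (prodErase β b).natDegree = n - 1 := by
  rw [prodErase, natDegree_finsetProd_X_sub_C_eq_card, Finset.card_erase_of_mem (Finset.mem_univ b),
    Finset.card_univ, Fintype.card_fin]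

theorem prodErase_ne_zero (β : Fin n → k) (b : Fin n) : prodErase β b ≠ 0 :=
  (monic_prod_X_sub_C β _).ne_zero

theorem eval_sum_smul_prodErase (β : Fin n → k) (c : Fin n → k) (i : Fin n) :
    (∑ b, c b • prodErase β b).eval (β i) = c i * (prodErase β i).eval (β i) := by
  rw [eval_finsetSum, Finset.sum_eq_single i]
  · rw [eval_smul, smul_eq_mul]
  · intro b _ hb
    rw [eval_smul, eval_prodErase_of_ne β hb, smul_zero]
  · simp

theorem linearIndependent_prodErase {β : Fin n → k} (hβ : Function.Injective β) :
    LinearIndependent k (prodErase β) := by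
  rw [Fintype.linearIndependent_iff]
  intro c hc i
  have h := eval_sum_smul_prodErase β c i
  rw [hc, eval_zero] at h
  exact (mul_eq_zero.1 h.symm).resolve_right (eval_prodErase_self_ne_zero hβ i)

theorem mem_span_prodErase {β : Fin n → k} (hβ : Function.Injective β) {p : k[X]}
    (hp : p.degree < n) : p ∈ Submodule.span k (Set.range (prodErase β)) := by
  -- The interpolation formula: both sides have degree below `n` and agree at the `n` distinct
  -- nodes.
  have h : p = ∑ b, (p.eval (β b) / (prodErase β b).eval (β b)) • prodErase β b := by
    refine eq_of_degrees_lt_of_eval_index_eq (v := β) Finset.univ hβ.injOn (by simpa using hp) ?_ ?_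
    · rw [Finset.card_univ, Fintype.card_fin, ← mem_degreeLT]
      refine sum_mem fun b _ => Submodule.smul_mem _ _ (mem_degreeLT.2 ?_)
      rw [degree_lt_iff_coeff_zero]
      intro m hm
      exact coeff_eq_zero_of_natDegree_lt (by
        rw [natDegree_prodErase]
        have := b.pos
        omega)
    · intro i _
      rw [eval_sum_smul_prodErase, div_mul_cancel₀ _ (eval_prodErase_self_ne_zero hβ i)]
  rw [h]
  exact sum_mem fun b _ => Submodule.smul_mem _ _ (Submodule.subset_span ⟨b, rfl⟩)

end Polynomial

/-! ### The basis of the Riemann–Roch space -/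

namespace Hermitian

variable {k : Type*} [Field k] {q : ℕ}

/-- `evalXY` as a linear map. -/
def evalXYₗ (k : Type*) [Field k] (q : ℕ) : (Fin q → k[X]) →ₗ[k] FunctionField k q where
  toFun := evalXY
  map_add' p p' := by simp [evalXY, add_mul, Finset.sum_add_distrib]
  map_smul' c p := by simp [evalXY, Finset.smul_sum]

theorem evalXY_single (a : Fin q) (p : k[X]) :
    evalXY (Pi.single a p) = aeval (x k q) p * y k q ^ (a : ℕ) := by
  rw [evalXY, Finset.sum_eq_single a]
  · rw [Pi.single_eq_same]
  · intro b _ hb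
    rw [Pi.single_eq_of_ne hb, map_zero, zero_mul]
  · simp

theorem term_le_weight {p : Fin q → k[X]} {a : Fin q} (ha : p a ≠ 0) :
    q * (p a).natDegree + (q + 1) * a ≤ weight p := by
  classical
  have := Finset.le_sup (f := fun a : Fin q =>
    if p a = 0 then 0 else q * (p a).natDegree + (q + 1) * (a : ℕ)) (Finset.mem_univ a)
  rw [if_neg ha] at this
  rw [weight]
  convert this

/-- Every `a < q` satisfies `a ≤ m`, so the truncated `m - a` is exact and the count is `q * m - (0
+ 1 + ⋯ + (q - 1))`. -/
theorem card_index {m : ℕ} (hm : q - 1 ≤ m) :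
    (Fintype.card (Index q m) : ℤ) = (m : ℤ) * q - genus q := by
  have h1 : Fintype.card (Index q m) + ∑ a ∈ Finset.range q, a = q * m := by
    rw [Fintype.card_sigma]
    simp only [Fintype.card_fin]
    rw [← Finset.sum_range fun a => m - a, ← Finset.sum_add_distrib,
      Finset.sum_congr rfl (g := fun _ => m), Finset.sum_const, Finset.card_range, smul_eq_mul]
    intro a ha
    have := Finset.mem_range.1 ha
    omega
  rw [Finset.sum_range_id] at h1
  rw [genus]
  have h2 : ((Fintype.card (Index q m) + q * (q - 1) / 2 : ℕ) : ℤ) = (q * m : ℕ) := by rw [h1]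
  rw [Nat.cast_add, Nat.cast_mul q m] at h2
  linarith

theorem weight_single {a : Fin q} {p : k[X]} (hp : p ≠ 0) :
    weight (Pi.single a p) = q * p.natDegree + (q + 1) * a := by
  refine le_antisymm ?_ ?_
  · rw [weight]
    refine Finset.sup_le fun b _ => ?_
    split_ifs with hb
    · exact Nat.zero_le _
    · obtain rfl : b = a := by
        by_contra hne
        exact hb (Pi.single_eq_of_ne hne _)
      rw [Pi.single_eq_same]
  · have := term_le_weight (p := Pi.single a p) (a := a) (by rwa [Pi.single_eq_same])
    rwa [Pi.single_eq_same] at this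

/-- The first `m - a` nodes. -/
def nodes {R : Type*} {m : ℕ} (α : Fin m → R) (a : ℕ) : Fin (m - a) → R :=
  fun j => α (j.castLE (Nat.sub_le m a))

theorem nodes_injective {R : Type*} {m : ℕ} {α : Fin m → R} (hα : Function.Injective α) (a : ℕ) :
    Function.Injective (nodes α a) :=
  hα.comp (Fin.castLE_injective _)

variable [hq : Fact (IsPrimePow q)]

theorem hBar_eq {m : ℕ} (α : Fin m → k) (s : Index q m) :
    hBar α s = evalXY (Pi.single s.1 (prodErase (nodes α s.1) s.2)) := by
  rw [evalXY_single, mul_comm, hBar, prodErase, map_prod]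
  simp [nodes]

/-- At the place at infinity a nonzero family has a nonzero value. -/
theorem evalXY_injective : Function.Injective (evalXYₗ k q) := by
  rw [← LinearMap.ker_eq_bot, LinearMap.ker_eq_bot']
  intro p hp
  by_contra h0
  obtain ⟨P, hP⟩ := exists_isAtInfinity (k := k) (q := q)
  exact evalXY_ne_zero P.valuation hP.one_lt_valuation_y h0 hp

theorem linearIndependent_hBar {m : ℕ} {α : Fin m → k} (hα : Function.Injective α) :
    LinearIndependent k (hBar (q := q) α) := by
  have h := (Pi.linearIndependent_single (R := k) (Ms := fun _ : Fin q => k[X])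
    (fun a => prodErase (nodes α a))
    fun a => linearIndependent_prodErase (nodes_injective hα a)).map'
    (evalXYₗ k q) (LinearMap.ker_eq_bot.2 evalXY_injective)
  rw [show hBar α = _ from funext (hBar_eq α)]
  exact h

/-- The span of the functions `hBar` consists of the `evalXY p` with `deg (p a) < m - a`. -/
theorem evalXY_mem_span_hBar {m : ℕ} {α : Fin m → k} (hα : Function.Injective α)
    {p : Fin q → k[X]} (hp : ∀ a, (p a).degree < ((m - a : ℕ) : WithBot ℕ)) :
    evalXY p ∈ Submodule.span k (Set.range (hBar (q := q) α)) := by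
  have h : evalXY p = ∑ a, evalXY (Pi.single a (p a)) := by
    simp only [evalXY_single]
    rfl
  rw [h]
  refine sum_mem fun a _ => ?_
  have h1 := Submodule.mem_map_of_mem (f := (evalXYₗ k q).comp (LinearMap.single k _ a))
    (mem_span_prodErase (nodes_injective hα a) (hp a))
  rw [Submodule.map_span] at h1
  refine Submodule.span_mono ?_ h1
  rintro _ ⟨_, ⟨b, rfl⟩, rfl⟩
  exact ⟨⟨a, b⟩, hBar_eq α ⟨a, b⟩⟩

theorem evalXY_mem_ring {P : Place k (FunctionField k q)} (hP : ¬ IsAtInfinity P)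
    (p : Fin q → k[X]) : evalXY p ∈ P.ring := by
  obtain ⟨hx, hy⟩ := not_or.1 hP
  refine sum_mem fun a _ => mul_mem ?_ (pow_mem (not_not.1 hy) _)
  rw [aeval_eq_sum_range]
  refine sum_mem fun i _ => ?_
  rw [Algebra.smul_def]
  exact mul_mem (P.algebraMap_mem _) (pow_mem (not_not.1 hx) _)

theorem span_hBar_eq (hq0 : (q : k) = 0) {m : ℕ} {α : Fin m → k} (hα : Function.Injective α)
    {Pinf : Place k (FunctionField k q)} (hP : IsAtInfinity Pinf) :
    Submodule.span k (Set.range (hBar (q := q) α))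
      = riemannRochSpace (Finsupp.single Pinf ((m : ℤ) * q - 1)) := by
  classical
  apply le_antisymm
  · rw [Submodule.span_le]
    rintro _ ⟨⟨a, b⟩, rfl⟩ P
    rw [hBar_eq]
    dsimp only
    by_cases h : P = Pinf
    · subst h
      have hne := prodErase_ne_zero (nodes α a) b
      rw [hP.valuation_evalXY (by simpa using hne), Finsupp.single_eq_same, WithZero.exp_le_exp,
        weight_single hne, natDegree_prodErase]
      have hb := b.pos
      have ha := a.2
      -- With `m = a + d + 1` the weight is `q * (m - 1) + a`, at most `m * q - 1` exactly because
      -- `a ≤ q - 1`.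
      obtain ⟨d, hd⟩ := Nat.exists_eq_add_of_lt (Nat.lt_of_sub_pos hb)
      rw [show m - a - 1 = d by omega, hd]
      push_cast
      nlinarith
    · rw [Finsupp.single_eq_of_ne h, WithZero.exp_zero, P.valuation_le_one_iff]
      exact evalXY_mem_ring (fun h' => h (h'.eq hP)) _
  · intro f hf
    obtain ⟨p, rfl⟩ := exists_eq_evalXY_of_forall_mem hq0 (f := f) fun P hP' => by
      have h := hf P
      rwa [Finsupp.single_eq_of_ne (by rintro rfl; exact hP' hP), WithZero.exp_zero,
        P.valuation_le_one_iff] at h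
    refine evalXY_mem_span_hBar hα fun a => ?_
    by_cases ha : p a = 0
    · rw [ha, degree_zero]
      exact WithBot.bot_lt_coe _
    have h := hf Pinf
    rw [hP.valuation_evalXY (by rintro rfl; exact ha rfl), Finsupp.single_eq_same,
      WithZero.exp_le_exp] at h
    have h1 : ((q * (p a).natDegree + (q + 1) * a : ℕ) : ℤ) ≤ weight p := by
      exact_mod_cast term_le_weight ha
    rw [degree_eq_natDegree ha]
    norm_cast
    -- The bound reads `q * (deg + a) + a ≤ m * q - 1`; dropping the summand `a` and cancelling `q`
    -- gives `deg + a < m`.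
    have h2 : q * ((p a).natDegree + a) < q * m := by
      zify
      push_cast at h1
      nlinarith
    have := lt_of_mul_lt_mul_left' h2
    omega

end Hermitian
end

theorem mainTheorem2 (q : ℕ) [Fact (IsPrimePow q)]
    (k : Type*) [Field k] [Fintype k] (hk : Fintype.card k = q ^ 2)
    (m : ℕ) (hm : q - 1 ≤ m) (hm' : m ≤ q ^ 2 - 1)
    (α : Fin m → k) (hα : Function.Injective α) (hα0 : ∀ i, α i ≠ 0)
    (L : ℤ) (hL : L = (m : ℤ) * q - Hermitian.genus q) :
    -- there is exactly one place at infinity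
    (∃! P : Place k (Hermitian.FunctionField k q), Hermitian.IsAtInfinity P) ∧
    -- the family consists of `L` different functions
    ((Set.range (Hermitian.hBar (q := q) α)).ncard : ℤ) = L ∧
    Function.Injective (Hermitian.hBar (q := q) α) ∧
    -- and it is a basis of the Riemann-Roch space
    ∀ Pinf : Place k (Hermitian.FunctionField k q), Hermitian.IsAtInfinity Pinf →
      riemannRochSpace (Finsupp.single Pinf (L + Hermitian.genus q - 1))
        = riemannRochSpace (Finsupp.single Pinf ((m : ℤ) * q - 1)) ∧
      LinearIndependent k (Hermitian.hBar (q := q) α) ∧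
      Submodule.span k (Set.range (Hermitian.hBar (q := q) α))
        = riemannRochSpace (Finsupp.single Pinf (L + Hermitian.genus q - 1)) := by
  -- The cardinality `q ^ 2` of `k` vanishes in `k`; this is what makes the affine curve smooth.
  have hq0 : (q : k) = 0 := by
    have h := FiniteField.cast_card_eq_zero k
    rw [hk, Nat.cast_pow] at h
    exact pow_eq_zero_iff two_ne_zero |>.1 h
  have hli := Hermitian.linearIndependent_hBar (q := q) hα
  have hD : L + Hermitian.genus q - 1 = (m : ℤ) * q - 1 := by rw [hL]; ring
  refine ⟨Hermitian.existsUnique_isAtInfinity, ?_, hli.injective, fun Pinf hP => ⟨by rw [hD], hli, ?_⟩⟩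
  · rw [← Set.image_univ, Set.ncard_image_of_injective _ hli.injective, Set.ncard_univ,
      Nat.card_eq_fintype_card, Hermitian.card_index hm, hL]
  · rw [hD, Hermitian.span_hBar_eq hq0 hα hP]
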